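/- **Theorem 4 (The Spectral Theorem for locally $AW^*$-algebras).** A *locally $C^*$-algebra* is a topological $*$-algebra over $\mathbb C$ that is topologically $*$-isomorphic to the projective limit $\varprojlim A_\alpha$ of a projective family of $C^*$-algebras over a directed set, with $*$-homomorphisms as connecting maps; its topology is called the projective topology. It is a *locally $AW^*$-algebra* if, moreover, it is a Baer $*$-algebra, i.e. for each nonempty $S\subseteq A$ the right annihilator $R(S)=\{y\in A: sy=0\ \forall s\in S\}$ equals $gA$ for some projection $g=g^*=g^2$. Projections are ordered by $e\le f\iff e=ef$, and suprema and infima of projections are taken in this order. A family of projections $(e_\lambda)_{\lambda\in\mathbb R}$ is *spectral* if $e_\lambda\le e_\mu$ for $\lambda\le\mu$, $\sup_\lambda e_\lambda=\mathbf 1$, $\inf_\lambda e_\lambda=\mathbf 0$, and $e_\lambda=\sup_{\mu<\lambda}e_\mu$ for all $\lambda$. Let $A$ be a locally $AW^*$-algebra. Then $A$ has an identity $\mathbf 1$, and for every self-adjoint $x\in A$ there is a unique spectral family of projections $(e_\lambda)_{\lambda\in\mathbb R}$ in $A$ such that $$x=\int_{-\infty}^{\infty}\lambda\,de_\lambda ,$$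 where the integral is the limit, in the projective topology of $A$, of the sums $\sum_{i=1}^{n}\mu_i(e_{\lambda_i}-e_{\lambda_{i-1}})$ with $\lambda_0<\dots<\lambda_n$ and $\lambda_{i-1}\le\mu_i\le\lambda_i$, as $\max_i(\lambda_i-\lambda_{i-1})\to0$, $\lambda_0\to-\infty$, $\lambda_n\to+\infty$. This family has the following properties. 1. For every $\lambda\in\mathbb R$, $e_\lambda=r\big((\lambda\mathbf 1-x)_+\big)$. Here $a_+$ is the positive part of a self-adjoint $a$, i.e. the unique positive element (element of the form $b^*b$) such that $a_+-a$ is positive and $a_+(a_+-a)=(a_+-a)a_+=\mathbf 0$; and $r(y)=\mathbf 1-g$, where $g$ is the projection with $R(\{y\})=gA$. 2. Every $e_\lambda$ belongs to every maximal commutative $*$-subalgebra $B$ of $A$ that contains $x$. 3. If $\|x\|_\infty:=\sup_p p(x)<\infty$, the supremum being over all continuous $C^*$-seminorms $p$ on $A$, then for every $\varepsilon>0$ $$x=\int_{-\|x\|_\infty}^{\|x\|_\infty+\varepsilon}\lambda\,de_\lambda ,$$ as the limit in the projective topology of the sums above over partitions of $[-\|x\|_\infty,\|x\|_\infty+\varepsilon]$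 as their mesh tends to $0$. -/

import Mathlib

open Filter Topology

universe u

namespace LocallyAW

/-- A projective family of C*-algebras (not assumed unital) over a partially ordered set `Λ`,
with *-homomorphisms `map : A_β → A_α` for `α ≤ β`. -/
structure ProjectiveFamily (Λ : Type u) [PartialOrder Λ] where
  obj : Λ → Type u
  cstar : ∀ α, NonUnitalCStarAlgebra (obj α)
  map : ∀ {α β : Λ}, α ≤ β → (obj β →⋆ₙₐ[ℂ] obj α)
  map_refl : ∀ (α : Λ) (x : obj α), map (le_refl α) x = x
  map_map : ∀ {α β γ : Λ} (h₁ : α ≤ β) (h₂ : β ≤ γ) (x : obj γ),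
    map h₁ (map h₂ x) = map (h₁.trans h₂) x

attribute [instance] ProjectiveFamily.cstar

/-- The projective limit: the *-algebra of compatible families in the direct product.
As a subset of the product it carries the subspace topology of the product topology
(the projective topology). -/
def ProjectiveFamily.limit {Λ : Type u} [PartialOrder Λ] (F : ProjectiveFamily Λ) :
    NonUnitalStarSubalgebra ℂ (∀ α, F.obj α) where
  carrier := {x | ∀ (α β : Λ) (h : α ≤ β), F.map h (x β) = x α}
  add_mem' := by
    intro a b ha hb α β h
    simp only [Pi.add_apply, map_add, ha α β h, hb α β h]
  zero_mem' := by
    intro α β h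
    simp only [Pi.zero_apply, map_zero]
  mul_mem' := by
    intro a b ha hb α β h
    simp only [Pi.mul_apply, map_mul, ha α β h, hb α β h]
  smul_mem' := by
    intro c a ha α β h
    simp only [Pi.smul_apply, map_smul, ha α β h]
  star_mem' := by
    intro a ha α β h
    simp only [Pi.star_apply, map_star, ha α β h]

section

variable (A : Type u) [NonUnitalRing A] [StarRing A] [Module ℂ A]

/-- A locally C*-algebra: a topological *-algebra which is topologically *-isomorphic to the
projective limit of a projective family of C*-algebras over a (nonempty) directed set. -/
def IsLocallyCStarAlgebra [TopologicalSpace A] : Prop :=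
  ∃ (Λ : Type u) (_ : PartialOrder Λ) (_ : IsDirectedOrder Λ) (_ : Nonempty Λ)
    (F : ProjectiveFamily Λ) (φ : A ≃⋆ₐ[ℂ] F.limit), IsHomeomorph φ

end

section

variable {A : Type u} [NonUnitalRing A] [StarRing A]

/-- The right annihilator `R(S) = {x : s x = 0 for all s ∈ S}`. -/
def rightAnnihilator (S : Set A) : Set A := {x | ∀ s ∈ S, s * x = 0}

/-- The set `gA`. -/
def principalRight (g : A) : Set A := Set.range fun a => g * a

/-- The order of projections: `e ≤ f` iff `e = ef`. -/
def ProjLE (e f : A) : Prop := e = e * f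

/-- `p` is the supremum of `S` in the partially ordered set of projections. -/
def IsProjSup (S : Set A) (p : A) : Prop :=
  IsStarProjection p ∧ (∀ e ∈ S, ProjLE e p) ∧
    ∀ q, IsStarProjection q → (∀ e ∈ S, ProjLE e q) → ProjLE p q

/-- `p` is the infimum of `S` in the partially ordered set of projections. -/
def IsProjInf (S : Set A) (p : A) : Prop :=
  IsStarProjection p ∧ (∀ e ∈ S, ProjLE p e) ∧
    ∀ q, IsStarProjection q → (∀ e ∈ S, ProjLE q e) → ProjLE q p

/-- `one` is a two-sided identity. -/
def IsUnitElement (one : A) : Prop := ∀ a : A, one * a = a ∧ a * one = a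

/-- `p` is the right support `1 - g` of `x`, where `g` is the projection with `R({x}) = gA`. -/
def IsRightSupport (one x p : A) : Prop :=
  ∃ g, IsStarProjection g ∧ rightAnnihilator {x} = principalRight g ∧ p = one - g

/-- Positive elements: those of the form `b* b`. -/
def IsPositive (a : A) : Prop := ∃ b : A, a = star b * b

/-- `a` is the positive part of `x`: `x = a - b` with `a, b` positive and `ab = ba = 0`. -/
def IsPositivePart (x a : A) : Prop :=
  ∃ b, IsPositive a ∧ IsPositive b ∧ x = a - b ∧ a * b = 0 ∧ b * a = 0

/-- A spectral family of projections. -/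
structure IsSpectralFamily (one : A) (e : ℝ → A) : Prop where
  isProj : ∀ t, IsStarProjection (e t)
  mono : ∀ s t, s ≤ t → ProjLE (e s) (e t)
  sup_eq_one : IsProjSup (Set.range e) one
  inf_eq_zero : IsProjInf (Set.range e) 0
  left_cont : ∀ t, IsProjSup (e '' Set.Iio t) (e t)

end

/-- A Baer *-algebra: the right annihilator of each nonempty subset is `gA` for a
projection `g`. -/
def IsBaerStar (A : Type u) [NonUnitalRing A] [StarRing A] : Prop :=
  ∀ S : Set A, S.Nonempty →
    ∃ g : A, IsStarProjection g ∧ rightAnnihilator S = principalRight g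

/-- A locally AW*-algebra: a locally C*-algebra which is a Baer *-algebra. -/
structure IsLocallyAWStarAlgebra (A : Type u) [NonUnitalRing A] [StarRing A] [Module ℂ A]
    [TopologicalSpace A] : Prop where
  locallyCStar : IsLocallyCStarAlgebra A
  baer : IsBaerStar A

/-- `p` is a continuous C*-seminorm. -/
structure IsContinuousCStarSeminorm {A : Type u} [NonUnitalRing A] [StarRing A] [Module ℂ A]
    [TopologicalSpace A] (p : Seminorm ℂ A) : Prop where
  mul_le : ∀ a b, p (a * b) ≤ p a * p b
  star_mul_self : ∀ a, p (star a * a) = p a ^ 2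
  cont : Continuous p

/-- `x` is bounded with `‖x‖_∞ = M`, where `‖x‖_∞` is the supremum of `p x` over all
continuous C*-seminorms `p`. -/
def HasSupNorm {A : Type u} [NonUnitalRing A] [StarRing A] [Module ℂ A]
    [TopologicalSpace A] (x : A) (M : ℝ) : Prop :=
  IsLUB {r : ℝ | ∃ p : Seminorm ℂ A, IsContinuousCStarSeminorm p ∧ r = p x} M

/-- A maximal commutative *-subalgebra. -/
def IsMaximalCommutative {A : Type u} [NonUnitalRing A] [StarRing A] [Module ℂ A]
    (B : NonUnitalStarSubalgebra ℂ A) : Prop :=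
  Maximal (fun C : NonUnitalStarSubalgebra ℂ A => ∀ a ∈ C, ∀ b ∈ C, a * b = b * a) B

/-- `l 0 < l 1 < ⋯ < l n` is a partition with tags `m i ∈ [l i, l (i + 1)]` and mesh less
than `δ`. -/
structure IsTaggedPartition (δ : ℝ) (n : ℕ) (l m : ℕ → ℝ) : Prop where
  lt : ∀ i < n, l i < l (i + 1)
  tag_ge : ∀ i < n, l i ≤ m i
  tag_le : ∀ i < n, m i ≤ l (i + 1)
  mesh : ∀ i < n, l (i + 1) - l i < δ

section

variable {A : Type u} [NonUnitalRing A] [Module ℂ A]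

/-- The Riemann–Stieltjes sum of the identity function against `e`. -/
def stieltjesSum (e : ℝ → A) (n : ℕ) (l m : ℕ → ℝ) : A :=
  ∑ i ∈ Finset.range n, (m i : ℂ) • (e (l (i + 1)) - e (l i))

variable [TopologicalSpace A]

/-- `∫_a^b t de_t = y`: the Riemann–Stieltjes sums over `[a, b]` converge to `y` in the
topology of `A` as the mesh tends to `0`. -/
def HasStieltjesIntegral (e : ℝ → A) (a b : ℝ) (y : A) : Prop :=
  ∀ U ∈ 𝓝 y, ∃ δ > 0, ∀ (n : ℕ) (l m : ℕ → ℝ), IsTaggedPartition δ n l m →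
    l 0 = a → l n = b → stieltjesSum e n l m ∈ U

/-- `∫_{-∞}^{∞} t de_t = y`: the Riemann–Stieltjes sums over `[l 0, l n]` converge to `y` in
the topology of `A` as the mesh tends to `0`, `l 0` to `-∞` and `l n` to `∞`. -/
def HasStieltjesIntegralLine (e : ℝ → A) (y : A) : Prop :=
  ∀ U ∈ 𝓝 y, ∃ δ > 0, ∃ R : ℝ, ∀ (n : ℕ) (l m : ℕ → ℝ), IsTaggedPartition δ n l m →
    l 0 ≤ -R → R ≤ l n → stieltjesSum e n l m ∈ U

end

end LocallyAW

/-!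
Work in the components of the projective limit, which are C*-algebras. There the right support
`e t` of `(t - x)₊` is recognized by two inequalities: `x` is at most `t` on `e t` and at least
`t` on `1 - e t`. Such cuts of `x` at levels `s < t` are comparable, and `x` lies between `s` and
`t` on `e t - e s`, so the Riemann–Stieltjes sums approximate `x` within the mesh of the partition.
Conversely, the components of a spectral family with integral `x` cut `x`; they are eventually
constant at `±∞`, hence patch to projections of the limit, which the supremum and infimum
conditions force to be `1` and `0`. Comparability of cuts at different levels, together with left
continuity, then gives uniqueness.
-/

namespace LocallyAW

section Projections

variable {R : Type*} [NonUnitalRing R] {p q : R}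

theorem ProjLE.map {R' G : Type*} [NonUnitalRing R'] [FunLike G R R'] [MulHomClass G R R']
    (g : G) (h : ProjLE p q) : ProjLE (g p) (g q) := by
  rw [ProjLE, ← map_mul, ← h]

variable [StarRing R]

theorem ProjLE.mul_eq_right (h : ProjLE p q) (hp : IsStarProjection p)
    (hq : IsStarProjection q) : q * p = p := by
  simpa [hp.isSelfAdjoint.star_eq, hq.isSelfAdjoint.star_eq] using congrArg star h.symm

theorem ProjLE.antisymm (h : ProjLE p q) (h' : ProjLE q p) (hp : IsStarProjection p)
    (hq : IsStarProjection q) : p = q :=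
  h.trans (h'.mul_eq_right hq hp)

theorem IsSpectralFamily.projLE_of_forall_lt {one : R} {f g : ℝ → R}
    (hf : IsSpectralFamily one f) (hg : IsSpectralFamily one g)
    (h : ∀ s t, s < t → ProjLE (f s) (g t)) (t : ℝ) : ProjLE (f t) (g t) := by
  refine (hf.left_cont t).2.2 _ (hg.isProj t) ?_
  rintro _ ⟨s, hs, rfl⟩
  exact h s t hs

/-- An increasing family of projections, such as the image of a spectral family under a
*-homomorphism; no suprema or infima are prescribed. -/
structure IsProjectionChain (f : ℝ → R) : Prop where
  isProj : ∀ t, IsStarProjection (f t)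
  mono : ∀ s t, s ≤ t → ProjLE (f s) (f t)

theorem IsSpectralFamily.isProjectionChain {one : R} {f : ℝ → R} (hf : IsSpectralFamily one f) :
    IsProjectionChain f :=
  ⟨hf.isProj, hf.mono⟩

namespace IsProjectionChain

variable {f : ℝ → R} {a b s t : ℝ}

theorem map {R' G : Type*} [NonUnitalRing R'] [StarRing R'] [FunLike G R R'] [MulHomClass G R R']
    [StarHomClass G R R'] (hf : IsProjectionChain f) (g : G) :
    IsProjectionChain fun t => g (f t) :=
  ⟨fun t => (hf.isProj t).map g, fun s t h => (hf.mono s t h).map g⟩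

theorem mul_of_le (hf : IsProjectionChain f) (h : s ≤ t) : f s * f t = f s :=
  (hf.mono s t h).symm

theorem mul_of_ge (hf : IsProjectionChain f) (h : s ≤ t) : f t * f s = f s :=
  (hf.mono s t h).mul_eq_right (hf.isProj s) (hf.isProj t)

theorem commute (hf : IsProjectionChain f) (s t : ℝ) : Commute (f s) (f t) := by
  rcases le_total s t with h | h
  · exact (hf.mul_of_le h).trans (hf.mul_of_ge h).symm
  · exact (hf.mul_of_ge h).trans (hf.mul_of_le h).symm

theorem isStarProjection_sub (hf : IsProjectionChain f) (h : s ≤ t) :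
    IsStarProjection (f t - f s) :=
  (hf.isProj s).sub_of_mul_eq_left (hf.isProj t) (hf.mul_of_le h)

theorem sub_mul_sub_of_le_left (hf : IsProjectionChain f) (hab : a ≤ b) (hbs : b ≤ s)
    (hst : s ≤ t) : (f b - f a) * (f t - f s) = 0 := by
  simp [sub_mul, mul_sub, hf.mul_of_le (hbs.trans hst), hf.mul_of_le hbs,
    hf.mul_of_le (hab.trans hbs), hf.mul_of_le (hab.trans (hbs.trans hst))]

theorem sub_mul_sub_of_le_right (hf : IsProjectionChain f) (hab : a ≤ b) (hta : t ≤ a)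
    (hst : s ≤ t) : (f b - f a) * (f t - f s) = 0 := by
  simp [sub_mul, mul_sub, hf.mul_of_ge hta, hf.mul_of_ge (hta.trans hab),
    hf.mul_of_ge (hst.trans hta), hf.mul_of_ge (hst.trans (hta.trans hab))]

theorem sub_mul_sub_of_le_of_le (hf : IsProjectionChain f) (has : a ≤ s) (hst : s ≤ t)
    (htb : t ≤ b) : (f b - f a) * (f t - f s) = f t - f s := by
  simp [sub_mul, mul_sub, hf.mul_of_ge htb, hf.mul_of_ge (hst.trans htb),
    hf.mul_of_le has, hf.mul_of_le (has.trans hst)]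

theorem isStarProjection_sub_mul_sub (hf : IsProjectionChain f) (hab : a ≤ b) (hst : s ≤ t) :
    IsStarProjection ((f b - f a) * (f t - f s)) :=
  (hf.isStarProjection_sub hab).mul (hf.isStarProjection_sub hst) <|
    ((hf.commute b t).sub_right (hf.commute b s)).sub_left
      ((hf.commute a t).sub_right (hf.commute a s))

theorem sum_sub_mul_sub (hf : IsProjectionChain f) {n : ℕ} {l : ℕ → ℝ} (h0 : l 0 ≤ s)
    (hst : s ≤ t) (hn : t ≤ l n) :
    ∑ i ∈ Finset.range n, (f (l (i + 1)) - f (l i)) * (f t - f s) = f t - f s := by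
  rw [← Finset.sum_mul, Finset.sum_range_sub fun i => f (l i),
    hf.sub_mul_sub_of_le_of_le h0 hst hn]

end IsProjectionChain

end Projections

section StieltjesIntegral

theorem exists_partition_mesh_lt {δ : ℝ} (hδ : 0 < δ) (R : ℝ) :
    ∃ (n : ℕ) (l : ℕ → ℝ), StrictMono l ∧ (∀ i, l (i + 1) - l i < δ) ∧ l 0 ≤ -R ∧ R ≤ l n := by
  obtain ⟨n, hn⟩ := Archimedean.arch (2 * R) (half_pos hδ)
  rw [nsmul_eq_mul] at hn
  refine ⟨n, fun i => -R + i * (δ / 2), fun i j hij => ?_, fun i => ?_, by simp, by linarith⟩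
  · have : (i : ℝ) < j := Nat.cast_lt.2 hij
    have := mul_lt_mul_of_pos_right this (half_pos hδ)
    dsimp only
    linarith
  · push_cast
    linarith

theorem IsTaggedPartition.le {δ : ℝ} {n : ℕ} {l m : ℕ → ℝ} (hP : IsTaggedPartition δ n l m) :
    l 0 ≤ l n := by
  have h : ∀ i ≤ n, l 0 ≤ l i := fun i => by
    induction i with
    | zero => exact fun _ => le_rfl
    | succ i ih => exact fun hi => (ih (by lia)).trans (hP.lt i hi).le
  exact h n le_rfl

variable {E : Type*} [NonUnitalRing E] [Module ℂ E]

/-- Here `k = 0` selects left tags and `k = 1` right tags. -/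
theorem HasStieltjesIntegralLine.mem_of_isClosed [TopologicalSpace E] {f : ℝ → E} {x : E}
    (hx : HasStieltjesIntegralLine f x) {K : Set E} (hK : IsClosed K) (R : ℝ) {k : ℕ}
    (hk : k ≤ 1)
    (H : ∀ (n : ℕ) (l : ℕ → ℝ), Monotone l → l 0 ≤ -R → R ≤ l n →
      stieltjesSum f n l (fun i => l (i + k)) ∈ K) : x ∈ K := by
  by_contra hxK
  obtain ⟨δ, hδ, R', hsum⟩ := hx Kᶜ (hK.isOpen_compl.mem_nhds hxK)
  obtain ⟨n, l, hl, hmesh, h0, hn⟩ := exists_partition_mesh_lt hδ (max R R')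
  have hP : IsTaggedPartition δ n l fun i => l (i + k) :=
    { lt := fun i _ => hl i.lt_succ_self
      tag_ge := fun i _ => hl.monotone (by lia)
      tag_le := fun i _ => hl.monotone (by lia)
      mesh := fun i _ => hmesh i }
  exact hsum n l _ hP (h0.trans (neg_le_neg (le_max_right _ _))) ((le_max_right _ _).trans hn)
    (H n l hl.monotone (h0.trans (neg_le_neg (le_max_left _ _))) ((le_max_left _ _).trans hn))

variable {E' G : Type*} [NonUnitalRing E'] [Module ℂ E'] [FunLike G E E'] [LinearMapClass G ℂ E E']

theorem map_stieltjesSum (g : G) (f : ℝ → E) (n : ℕ) (l m : ℕ → ℝ) :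
    g (stieltjesSum f n l m) = stieltjesSum (fun t => g (f t)) n l m := by
  simp only [stieltjesSum, map_sum, map_smul, map_sub]

theorem HasStieltjesIntegralLine.map [TopologicalSpace E] [TopologicalSpace E'] {f : ℝ → E}
    {x : E} (hx : HasStieltjesIntegralLine f x) (g : G) (hg : Continuous g) :
    HasStieltjesIntegralLine (fun t => g (f t)) (g x) := by
  intro U hU
  obtain ⟨δ, hδ, R, hsum⟩ := hx _ (hg.continuousAt hU)
  refine ⟨δ, hδ, R, fun n l m hP h0 hn => ?_⟩
  rw [← map_stieltjesSum]
  exact hsum n l m hP h0 hn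

end StieltjesIntegral

section OrderedAlgebra

variable {R : Type*} [NonUnitalRing R] [StarRing R] [PartialOrder R] [Module ℝ R]

/-- The projection `p` cuts `x` at the level `t` inside the corner with unit `u`: on `p` the
element `x` is at most `t`, on `u - p` it is at least `t`. The unit `u` is a parameter because a
component of a projective limit need not have the image of the identity as an identity. -/
structure IsCut (u x : R) (t : ℝ) (p : R) : Prop where
  isProj : IsStarProjection p
  projLE_unit : ProjLE p u
  commute : Commute x p
  mul_le : x * p ≤ t • p
  le_mul : t • (u - p) ≤ x * (u - p)

/-- The chain `f` resolves `x`: on `f t - f s` the element `x` lies between `s` and `t`. This is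
what remains of `x = ∫ t df t` without any condition on `f` at `±∞`. -/
structure IsSpectralResolution (x : R) (f : ℝ → R) : Prop extends IsProjectionChain f where
  commute_left : ∀ t, Commute x (f t)
  mul_sub_le : ∀ s t, s ≤ t → x * (f t - f s) ≤ t • (f t - f s)
  le_mul_sub : ∀ s t, s ≤ t → s • (f t - f s) ≤ x * (f t - f s)

theorem IsSpectralResolution.isCut {x u : R} {f : ℝ → R} {s t r : ℝ}
    (hf : IsSpectralResolution x f) (hst : s ≤ t) (htr : t ≤ r) (hs : f s = 0) (hr : f r = u) :
    IsCut u x t (f t) where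
  isProj := hf.isProj t
  projLE_unit := hr ▸ hf.mono t r htr
  commute := hf.commute_left t
  mul_le := by simpa only [hs, sub_zero] using hf.mul_sub_le s t hst
  le_mul := hr ▸ hf.le_mul_sub t r htr

theorem IsCut.isStarProjection_unit_sub {x u p : R} {t : ℝ} (hu : IsStarProjection u)
    (hp : IsCut u x t p) : IsStarProjection (u - p) :=
  hp.isProj.sub_of_mul_eq_left hu hp.projLE_unit.symm

variable [StarOrderedRing R] [IsScalarTower ℝ R R] [SMulCommClass ℝ R R]

theorem mul_conjugate_le_smul {x y c : R} {t : ℝ} (hc : Commute x (star c))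
    (h : x * y ≤ t • y) : x * (star c * y * c) ≤ t • (star c * y * c) := by
  simpa only [mul_assoc, ← hc.left_comm, smul_mul_assoc, mul_smul_comm] using
    star_left_conjugate_le_conjugate h c

theorem smul_conjugate_le_mul {x y c : R} {t : ℝ} (hc : Commute x (star c))
    (h : t • y ≤ x * y) : t • (star c * y * c) ≤ x * (star c * y * c) := by
  simpa only [mul_assoc, ← hc.left_comm, smul_mul_assoc, mul_smul_comm] using
    star_left_conjugate_le_conjugate h c

namespace IsCut

variable {u x p q : R} {s t : ℝ}

theorem mul_sub_le (hp : IsCut u x s p) (hq : IsCut u x t q) (hpq : ProjLE p q) :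
    x * (q - p) ≤ t • (q - p) := by
  have hd := hp.isProj.sub_of_mul_eq_left hq.isProj hpq.symm
  have hconj : star (q - p) * q * (q - p) = q - p := by
    rw [hd.isSelfAdjoint.star_eq, sub_mul, hq.isProj.isIdempotentElem.eq, hpq.symm,
      hd.isIdempotentElem.eq]
  rw [← hconj]
  refine mul_conjugate_le_smul ?_ hq.mul_le
  rw [hd.isSelfAdjoint.star_eq]
  exact hq.commute.sub_right hp.commute

theorem le_mul_sub (hp : IsCut u x s p) (hq : IsCut u x t q) (hpq : ProjLE p q) :
    s • (q - p) ≤ x * (q - p) := by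
  have hd := hp.isProj.sub_of_mul_eq_left hq.isProj hpq.symm
  have hcorner : (q - p) * (u - p) = q - p := by
    rw [mul_sub (q - p), sub_mul, sub_mul, ← hq.projLE_unit, ← hp.projLE_unit,
      hp.isProj.isIdempotentElem.eq, hpq.mul_eq_right hp.isProj hq.isProj, sub_self, sub_zero]
  have hconj : star (q - p) * (u - p) * (q - p) = q - p := by
    rw [hd.isSelfAdjoint.star_eq, hcorner, hd.isIdempotentElem.eq]
  rw [← hconj]
  refine smul_conjugate_le_mul ?_ hp.le_mul
  rw [hd.isSelfAdjoint.star_eq]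
  exact hq.commute.sub_right hp.commute

end IsCut

end OrderedAlgebra

section CStarAlgebra

variable {C : Type*} [NonUnitalCStarAlgebra C] [PartialOrder C] [StarOrderedRing C]
  {x u p q d : C} {s t : ℝ}

theorem norm_le_norm_of_neg_le_of_le {a y : C} (ha : IsSelfAdjoint a) (hy : IsSelfAdjoint y)
    (hay : -a ≤ y) (hya : y ≤ a) : ‖y‖ ≤ ‖a‖ := by
  have hbound : (a : Unitization ℂ C) ≤ algebraMap ℝ _ ‖a‖ := by
    simpa only [Unitization.norm_inr] using (ha.inr ℂ).le_algebraMap_norm_self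
  have hupper : (y : Unitization ℂ C) ≤ algebraMap ℝ _ ‖a‖ :=
    ((Unitization.inr_le_iff y a hy ha).2 hya).trans hbound
  have hlower : algebraMap ℝ (Unitization ℂ C) (-‖a‖) ≤ y := by
    have h := (Unitization.inr_le_iff (-a) y ha.neg hy).2 hay
    rw [Unitization.inr_neg] at h
    rw [map_neg]
    exact (neg_le_neg hbound).trans h
  rw [le_algebraMap_iff_spectrum_le (ha := hy.inr ℂ)] at hupper
  rw [algebraMap_le_iff_le_spectrum (ha := hy.inr ℂ)] at hlower
  rw [← Unitization.norm_inr (𝕜 := ℂ) (a := y)]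
  rcases CStarAlgebra.norm_or_neg_norm_mem_spectrum (hy.inr ℂ) with h | h
  · exact hupper _ h
  · exact neg_le_neg_iff.1 (hlower _ h)

theorem eq_zero_of_smul_le_smul (hd : 0 ≤ d) (hst : s < t) (h : t • d ≤ s • d) : d = 0 := by
  refine le_antisymm ?_ hd
  have hsub : (t - s) • d ≤ (t - s) • (0 : C) := by
    rw [sub_smul, smul_zero]
    exact sub_nonpos.2 h
  exact (smul_le_smul_iff_of_pos_left (sub_pos.2 hst)).1 hsub

theorem eq_zero_of_smul_le_mul (hd : 0 ≤ d) (ht : ‖x‖ < t) (h : t • d ≤ x * d) : d = 0 := by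
  have ht0 : 0 ≤ t := (norm_nonneg x).trans ht.le
  have hnorm : t * ‖d‖ ≤ ‖x‖ * ‖d‖ := by
    calc t * ‖d‖ = ‖t • d‖ := by rw [norm_smul, Real.norm_of_nonneg ht0]
      _ ≤ ‖x * d‖ := CStarAlgebra.norm_le_norm_of_nonneg_of_le (smul_nonneg ht0 hd) h
      _ ≤ ‖x‖ * ‖d‖ := norm_mul_le x d
  exact norm_le_zero_iff.1 (by nlinarith [norm_nonneg d])

theorem eq_zero_of_mul_le_smul (hd : 0 ≤ d) (ht : t < -‖x‖) (h : x * d ≤ t • d) : d = 0 := by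
  refine eq_zero_of_smul_le_mul (x := -x) hd (t := -t) (by rw [norm_neg]; linarith) ?_
  simpa only [neg_smul, neg_mul] using neg_le_neg h

namespace IsCut

theorem eq_unit_of_norm_lt (hu : IsStarProjection u) (hp : IsCut u x t p) (ht : ‖x‖ < t) :
    p = u :=
  (sub_eq_zero.1 <|
    eq_zero_of_smul_le_mul (hp.isStarProjection_unit_sub hu).nonneg ht hp.le_mul).symm

theorem eq_zero_of_lt_neg_norm (hp : IsCut u x t p) (ht : t < -‖x‖) : p = 0 :=
  eq_zero_of_mul_le_smul hp.isProj.nonneg ht hp.mul_le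

theorem projLE_of_lt (hu : IsStarProjection u) (hxu : Commute x u) (hp : IsCut u x s p)
    (hq : IsCut u x t q) (hst : s < t) : ProjLE p q := by
  set r := u - q with hr
  have hr_proj : IsStarProjection r := hq.isStarProjection_unit_sub hu
  have hxr : Commute x r := hxu.sub_right hq.commute
  have hpp : p * p = p := hp.isProj.isIdempotentElem
  have hps : star p = p := hp.isProj.isSelfAdjoint
  have hprp_nonneg : 0 ≤ p * r * p := by
    simpa only [hps] using star_left_conjugate_nonneg hr_proj.nonneg p
  have hlower : t • (p * r * p) ≤ x * (p * r * p) := by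
    simpa only [hps] using
      smul_conjugate_le_mul (c := p) (by rw [hps]; exact hp.commute) hq.le_mul
  have hupper : x * (p * r * p) ≤ s • (p * r * p) := by
    have hcomm : Commute (s • p - x * p) (p * r * p) := by
      have hp' : Commute p (p * r * p) := by
        simp only [commute_iff_eq, mul_assoc, hpp]
        simp only [← mul_assoc, hpp]
      exact (hp'.smul_left s).sub_left
        (((hp.commute.mul_right hxr).mul_right hp.commute).mul_left hp')
    have hmul := hcomm.mul_nonneg (sub_nonneg.2 hp.mul_le) hprp_nonneg
    rw [sub_mul, smul_mul_assoc, mul_assoc x, ← mul_assoc p (p * r) p, ← mul_assoc p p r,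
      hpp] at hmul
    exact sub_nonneg.1 hmul
  have hprp : p * r * p = 0 :=
    eq_zero_of_smul_le_smul hprp_nonneg hst (hlower.trans hupper)
  have hrp : r * p = 0 := by
    rw [← CStarRing.star_mul_self_eq_zero_iff, star_mul, hps, hr_proj.isSelfAdjoint.star_eq,
      mul_assoc, ← mul_assoc r r p, hr_proj.isIdempotentElem.eq, ← mul_assoc, hprp]
  have hpr : p * r = 0 := by
    simpa [hps, hr_proj.isSelfAdjoint.star_eq] using congrArg star hrp
  rwa [hr, mul_sub, ← hp.projLE_unit, sub_eq_zero] at hpr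

end IsCut

namespace IsSpectralResolution

variable {f : ℝ → C}

theorem of_isCut (hmono : ∀ s t, s ≤ t → ProjLE (f s) (f t)) (hf : ∀ t, IsCut u x t (f t)) :
    IsSpectralResolution x f where
  isProj t := (hf t).isProj
  mono := hmono
  commute_left t := (hf t).commute
  mul_sub_le s t hst := (hf s).mul_sub_le (hf t) (hmono s t hst)
  le_mul_sub s t hst := (hf s).le_mul_sub (hf t) (hmono s t hst)

theorem eventuallyConst_atTop (hf : IsSpectralResolution x f) : EventuallyConst f atTop := by
  refine eventuallyConst_iff_exists_eventuallyEq.2 ⟨f (‖x‖ + 1), ?_⟩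
  filter_upwards [eventually_ge_atTop (‖x‖ + 1)] with t ht
  exact sub_eq_zero.1 <| eq_zero_of_smul_le_mul (hf.isStarProjection_sub ht).nonneg
    (lt_add_one _) (hf.le_mul_sub _ t ht)

theorem eventuallyConst_atBot (hf : IsSpectralResolution x f) : EventuallyConst f atBot := by
  refine eventuallyConst_iff_exists_eventuallyEq.2 ⟨f (-‖x‖ - 1), ?_⟩
  filter_upwards [eventually_le_atBot (-‖x‖ - 1)] with t ht
  exact (sub_eq_zero.1 <| eq_zero_of_mul_le_smul (hf.isStarProjection_sub ht).nonneg
    (sub_one_lt _) (hf.mul_sub_le t _ ht)).symm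

theorem isSelfAdjoint_smul_sub_mul (hf : IsSpectralResolution x f) (m : ℝ) (hst : s ≤ t) :
    IsSelfAdjoint (m • (f t - f s) - x * (f t - f s)) := by
  have hsa : ∀ r : ℝ, IsSelfAdjoint (r • (f t - f s)) := fun r =>
    (IsSelfAdjoint.all r).smul (hf.isStarProjection_sub hst).isSelfAdjoint
  have h := (sub_nonneg.2 (hf.mul_sub_le s t hst)).isSelfAdjoint
  simpa only [sub_add_sub_cancel] using ((hsa m).sub (hsa t)).add h

theorem smul_sub_mul_mem_Icc (hf : IsSpectralResolution x f) {m δ : ℝ} (hsm : s ≤ m)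
    (hmt : m ≤ t) (hδ : t - s ≤ δ) :
    m • (f t - f s) - x * (f t - f s) ∈ Set.Icc (-(δ • (f t - f s))) (δ • (f t - f s)) := by
  have hst := hsm.trans hmt
  have hmono : ∀ {a b : ℝ}, a ≤ b → a • (f t - f s) ≤ b • (f t - f s) := fun h =>
    smul_le_smul_of_nonneg_right h (hf.isStarProjection_sub hst).nonneg
  constructor
  · calc -(δ • (f t - f s)) ≤ s • (f t - f s) - t • (f t - f s) := by
          rw [← neg_smul, ← sub_smul]
          exact hmono (by linarith)
      _ ≤ m • (f t - f s) - x * (f t - f s) := sub_le_sub (hmono hsm) (hf.mul_sub_le s t hst)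
  · calc m • (f t - f s) - x * (f t - f s) ≤ t • (f t - f s) - s • (f t - f s) :=
          sub_le_sub (hmono hmt) (hf.le_mul_sub s t hst)
      _ ≤ δ • (f t - f s) := by
          rw [← sub_smul]
          exact hmono hδ

theorem norm_smul_sub_mul_le (hf : IsSpectralResolution x f) (hst : s ≤ t) :
    ‖t • (f t - f s) - x * (f t - f s)‖ ≤ t - s := by
  have hproj := hf.isStarProjection_sub hst
  calc ‖t • (f t - f s) - x * (f t - f s)‖ ≤ ‖(t - s) • (f t - f s)‖ :=
        CStarAlgebra.norm_le_norm_of_nonneg_of_le (sub_nonneg.2 (hf.mul_sub_le s t hst))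
          (hf.smul_sub_mul_mem_Icc hst le_rfl le_rfl).2
    _ ≤ t - s := by
        rw [norm_smul, Real.norm_of_nonneg (sub_nonneg.2 hst)]
        exact mul_le_of_le_one_right (sub_nonneg.2 hst) hproj.norm_le

theorem smul_sub_mul_mul_eq_zero (hf : IsSpectralResolution x f) {r : C}
    (hr : ∀ s < t, f s * r = 0) : (t • f t - x * f t) * r = 0 := by
  have hbound : ∀ s < t, ‖(t • f t - x * f t) * r‖ ≤ (t - s) * ‖r‖ := by
    intro s hst
    have hband : (t • f t - x * f t) * r = (t • (f t - f s) - x * (f t - f s)) * r := by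
      simp only [sub_mul, mul_sub, smul_sub, smul_mul_assoc, mul_assoc, hr s hst, mul_zero,
        smul_zero, sub_zero]
    rw [hband]
    exact (norm_mul_le _ _).trans
      (mul_le_mul_of_nonneg_right (hf.norm_smul_sub_mul_le hst.le) (norm_nonneg r))
  have hlim : Tendsto (fun s : ℝ => (t - s) * ‖r‖) (𝓝[<] t) (𝓝 0) := by
    have hcont : Continuous fun s : ℝ => (t - s) * ‖r‖ := by fun_prop
    simpa using (hcont.tendsto t).mono_left nhdsWithin_le_nhds
  exact norm_le_zero_iff.1 (ge_of_tendsto hlim (eventually_mem_nhdsWithin.mono hbound))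

theorem norm_stieltjesSum_sub_le (hf : IsSpectralResolution x f) {δ : ℝ} (hδ : 0 ≤ δ) {n : ℕ}
    {l m : ℕ → ℝ} (hP : IsTaggedPartition δ n l m) :
    ‖stieltjesSum f n l m - x * (f (l n) - f (l 0))‖ ≤ δ := by
  have hsum : ∑ i ∈ Finset.range n, (f (l (i + 1)) - f (l i)) = f (l n) - f (l 0) :=
    Finset.sum_range_sub (fun i => f (l i)) n
  have hS : stieltjesSum f n l m - x * (f (l n) - f (l 0)) = ∑ i ∈ Finset.range n,
      (m i • (f (l (i + 1)) - f (l i)) - x * (f (l (i + 1)) - f (l i))) := by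
    rw [Finset.sum_sub_distrib, ← Finset.mul_sum, hsum]
    simp only [stieltjesSum, Complex.coe_smul]
  have hterm : ∀ i ∈ Finset.range n,
      m i • (f (l (i + 1)) - f (l i)) - x * (f (l (i + 1)) - f (l i)) ∈
        Set.Icc (-(δ • (f (l (i + 1)) - f (l i)))) (δ • (f (l (i + 1)) - f (l i))) := by
    intro i hi
    rw [Finset.mem_range] at hi
    exact hf.smul_sub_mul_mem_Icc (hP.tag_ge i hi) (hP.tag_le i hi) (hP.mesh i hi).le
  have hproj := hf.isStarProjection_sub hP.le
  calc ‖stieltjesSum f n l m - x * (f (l n) - f (l 0))‖ ≤ ‖δ • (f (l n) - f (l 0))‖ := by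
        refine norm_le_norm_of_neg_le_of_le
          ((IsSelfAdjoint.all δ).smul hproj.isSelfAdjoint) ?_ ?_ ?_ <;>
          rw [hS]
        · exact isSelfAdjoint_sum _ fun i hi =>
            hf.isSelfAdjoint_smul_sub_mul _ (hP.lt i (Finset.mem_range.1 hi)).le
        · rw [← hsum, Finset.smul_sum, ← Finset.sum_neg_distrib]
          exact Finset.sum_le_sum fun i hi => (hterm i hi).1
        · rw [← hsum, Finset.smul_sum]
          exact Finset.sum_le_sum fun i hi => (hterm i hi).2
    _ ≤ δ := by
        rw [norm_smul, Real.norm_of_nonneg hδ]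
        exact mul_le_of_le_one_right hδ hproj.norm_le

theorem hasStieltjesIntegral (hf : IsSpectralResolution x f) {a b : ℝ}
    (hx : x * (f b - f a) = x) : HasStieltjesIntegral f a b x := by
  intro U hU
  obtain ⟨δ, hδ, hball⟩ := Metric.mem_nhds_iff.1 hU
  refine ⟨δ / 2, half_pos hδ, fun n l m hP h0 hn => hball ?_⟩
  have h := hf.norm_stieltjesSum_sub_le (half_pos hδ).le hP
  rw [h0, hn, hx] at h
  rw [Metric.mem_ball, dist_eq_norm]
  linarith

theorem hasStieltjesIntegralLine (hf : IsSpectralResolution x f)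
    (hbot : ∀ᶠ t in atBot, f t = 0) (htop : ∀ᶠ t in atTop, x * f t = x) :
    HasStieltjesIntegralLine f x := by
  intro U hU
  obtain ⟨δ, hδ, hball⟩ := Metric.mem_nhds_iff.1 hU
  obtain ⟨a, ha⟩ := eventually_atBot.1 hbot
  obtain ⟨b, hb⟩ := eventually_atTop.1 htop
  refine ⟨δ / 2, half_pos hδ, max (-a) b, fun n l m hP h0 hn => hball ?_⟩
  have h := hf.norm_stieltjesSum_sub_le (half_pos hδ).le hP
  rw [ha (l 0) (by linarith [le_max_left (-a) b]), sub_zero,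
    hb (l n) ((le_max_right _ _).trans hn)] at h
  rw [Metric.mem_ball, dist_eq_norm]
  linarith

end IsSpectralResolution

namespace IsProjectionChain

variable {f : ℝ → C} {n : ℕ} {l : ℕ → ℝ}

theorem stieltjesSum_mul_sub_le (hf : IsProjectionChain f) (hl : Monotone l) (h0 : l 0 ≤ s)
    (hst : s ≤ t) (hn : t ≤ l n) : stieltjesSum f n l l * (f t - f s) ≤ t • (f t - f s) := by
  nth_rw 2 [← hf.sum_sub_mul_sub h0 hst hn]
  rw [stieltjesSum, Finset.sum_mul, Finset.smul_sum]
  refine Finset.sum_le_sum fun i _ => ?_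
  rw [smul_mul_assoc, Complex.coe_smul]
  rcases le_total (l i) t with hi | hi
  · exact smul_le_smul_of_nonneg_right hi
      (hf.isStarProjection_sub_mul_sub (hl i.le_succ) hst).nonneg
  · rw [hf.sub_mul_sub_of_le_right (hl i.le_succ) hi hst, smul_zero, smul_zero]

theorem le_stieltjesSum_mul_sub (hf : IsProjectionChain f) (hl : Monotone l) (h0 : l 0 ≤ s)
    (hst : s ≤ t) (hn : t ≤ l n) :
    s • (f t - f s) ≤ stieltjesSum f n l (fun i => l (i + 1)) * (f t - f s) := by
  nth_rw 1 [← hf.sum_sub_mul_sub h0 hst hn]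
  rw [stieltjesSum, Finset.sum_mul, Finset.smul_sum]
  refine Finset.sum_le_sum fun i _ => ?_
  rw [smul_mul_assoc, Complex.coe_smul]
  rcases le_total s (l (i + 1)) with hi | hi
  · exact smul_le_smul_of_nonneg_right hi
      (hf.isStarProjection_sub_mul_sub (hl i.le_succ) hst).nonneg
  · rw [hf.sub_mul_sub_of_le_left (hl i.le_succ) hi hst, smul_zero, smul_zero]

theorem isSpectralResolution (hf : IsProjectionChain f) (hx : HasStieltjesIntegralLine f x) :
    IsSpectralResolution x f where
  toIsProjectionChain := hf
  commute_left t := by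
    have hclosed : IsClosed {y : C | Commute y (f t)} :=
      isClosed_eq (continuous_mul_const _) (continuous_const_mul _)
    refine hx.mem_of_isClosed hclosed 0 zero_le_one fun n l _ _ _ => ?_
    exact Commute.sum_left _ _ _ fun i _ =>
      ((hf.commute _ t).sub_left (hf.commute _ t)).smul_left _
  mul_sub_le s t hst := by
    have hclosed : IsClosed {y : C | y * (f t - f s) ≤ t • (f t - f s)} :=
      isClosed_le (continuous_mul_const _) continuous_const
    refine hx.mem_of_isClosed hclosed (max |s| |t|) zero_le_one fun n l hl h0 hn => ?_
    exact hf.stieltjesSum_mul_sub_le hl (by grind) hst (by grind)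
  le_mul_sub s t hst := by
    have hclosed : IsClosed {y : C | s • (f t - f s) ≤ y * (f t - f s)} :=
      isClosed_le continuous_const (continuous_mul_const _)
    refine hx.mem_of_isClosed hclosed (max |s| |t|) le_rfl fun n l hl h0 hn => ?_
    exact hf.le_stieltjesSum_mul_sub hl (by grind) hst (by grind)

end IsProjectionChain

end CStarAlgebra

attribute [local instance] CStarAlgebra.spectralOrder CStarAlgebra.spectralOrderedRing

section Coordinates

variable {A : Type u} [NonUnitalRing A] [StarRing A] [Module ℂ A]
  {Λ : Type u} [PartialOrder Λ] {F : ProjectiveFamily Λ}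

/-- The canonical homomorphism of a projective limit, presented by the isomorphism `φ`, to its
component of index `α`. -/
def coord (φ : A ≃⋆ₐ[ℂ] F.limit) (α : Λ) : A →⋆ₙₐ[ℂ] F.obj α where
  toFun a := (φ a : ∀ α, F.obj α) α
  map_smul' c a := by rw [map_smul]; rfl
  map_zero' := by rw [map_zero]; rfl
  map_add' a b := by rw [map_add]; rfl
  map_mul' a b := by rw [map_mul]; rfl
  map_star' a := by rw [map_star]; rfl

variable (φ : A ≃⋆ₐ[ℂ] F.limit)

theorem map_coord {α β : Λ} (h : α ≤ β) (a : A) : F.map h (coord φ β a) = coord φ α a :=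
  (φ a).2 α β h

theorem ext_coord {a b : A} (h : ∀ α, coord φ α a = coord φ α b) : a = b :=
  φ.injective (Subtype.ext (funext h))

theorem exists_coord_eq {z : ∀ α, F.obj α}
    (hz : ∀ (α β : Λ) (h : α ≤ β), F.map h (z β) = z α) : ∃ a : A, ∀ α, coord φ α a = z α :=
  ⟨φ.symm ⟨z, hz⟩, fun α => congrFun (congrArg Subtype.val (φ.apply_symm_apply ⟨z, hz⟩)) α⟩

theorem exists_eventually_coord_eq {ι : Type*} {l : Filter ι} [l.NeBot] {f : ι → A}
    (hf : ∀ α, EventuallyConst (fun i => coord φ α (f i)) l) :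
    ∃ a : A, ∀ α, ∀ᶠ i in l, coord φ α (f i) = coord φ α a := by
  have hlim : ∀ α, ∃ z, ∀ᶠ i in l, coord φ α (f i) = z := fun α =>
    eventuallyConst_iff_exists_eventuallyEq.1 (hf α)
  choose z hz using hlim
  obtain ⟨a, ha⟩ := exists_coord_eq φ (z := z) fun α β h => by
    obtain ⟨i, hα, hβ⟩ := ((hz α).and (hz β)).exists
    rw [← hα, ← hβ, map_coord]
  exact ⟨a, fun α => by simpa only [ha] using hz α⟩

theorem coord_ofReal_smul (α : Λ) (r : ℝ) (a : A) :
    coord φ α ((r : ℂ) • a) = r • coord φ α a := by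
  rw [map_smul, Complex.coe_smul]

theorem isStarProjection_of_coord {p : A} (hp : ∀ α, IsStarProjection (coord φ α p)) :
    IsStarProjection p where
  isIdempotentElem := ext_coord φ fun α => (map_mul _ p p).trans (hp α).isIdempotentElem
  isSelfAdjoint := ext_coord φ fun α => (map_star _ p).trans (hp α).isSelfAdjoint

theorem exists_isStarProjection_eventually_coord_eq {ι : Type*} {l : Filter ι} [l.NeBot]
    {f : ι → A} (hf : ∀ i, IsStarProjection (f i))
    (hconst : ∀ α, EventuallyConst (fun i => coord φ α (f i)) l) :
    ∃ q : A, IsStarProjection q ∧ ∀ α, ∀ᶠ i in l, coord φ α (f i) = coord φ α q := by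
  obtain ⟨q, hq⟩ := exists_eventually_coord_eq φ hconst
  refine ⟨q, isStarProjection_of_coord φ fun α => ?_, hq⟩
  obtain ⟨i, hi⟩ := (hq α).exists
  exact hi ▸ (hf i).map (coord φ α)

theorem projLE_of_coord {p q : A} (h : ∀ α, ProjLE (coord φ α p) (coord φ α q)) : ProjLE p q :=
  ext_coord φ fun α => (h α).trans (map_mul _ p q).symm

theorem IsPositive.coord_nonneg {a : A} (ha : IsPositive a) (α : Λ) : 0 ≤ coord φ α a := by
  obtain ⟨b, rfl⟩ := ha
  rw [map_mul, map_star]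
  exact star_mul_self_nonneg _

theorem exists_coord_eq_cfcₙ {g : ℝ → ℝ} (hg : Continuous g) (hg0 : g 0 = 0) {y : A}
    (hy : IsSelfAdjoint y) : ∃ a : A, ∀ α, coord φ α a = cfcₙ g (coord φ α y) := by
  refine exists_coord_eq φ fun α β h => ?_
  rw [← map_coord φ h y]
  exact NonUnitalStarAlgHomClass.map_cfcₙ (F.map h) g (coord φ β y) hg.continuousOn hg0
    (map_continuous (F.map h)) (hy.map _) ((hy.map (coord φ β)).map _)

theorem exists_isPositive_coord_eq_cfcₙ {g : ℝ → ℝ} (hg : Continuous g) (hg0 : g 0 = 0)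
    (hg_nonneg : ∀ t, 0 ≤ g t) {y : A} (hy : IsSelfAdjoint y) :
    ∃ a : A, IsPositive a ∧ ∀ α, coord φ α a = cfcₙ g (coord φ α y) := by
  obtain ⟨c, hc⟩ := exists_coord_eq_cfcₙ φ (g := fun t => √(g t)) (by fun_prop)
    (by rw [hg0, Real.sqrt_zero]) hy
  refine ⟨star c * c, ⟨c, rfl⟩, fun α => ?_⟩
  rw [map_mul, map_star, hc, (cfcₙ_predicate _ _ : IsSelfAdjoint _).star_eq,
    ← cfcₙ_mul _ _ _ (by fun_prop) (by simp [hg0]) (by fun_prop) (by simp [hg0])]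
  simp only [Real.mul_self_sqrt (hg_nonneg _)]

theorem exists_isPositivePart (φ : A ≃⋆ₐ[ℂ] F.limit) {y : A} (hy : IsSelfAdjoint y) :
    ∃ a, IsPositivePart y a := by
  obtain ⟨a, ha, ha'⟩ :=
    exists_isPositive_coord_eq_cfcₙ φ continuous_posPart posPart_zero posPart_nonneg hy
  obtain ⟨b, hb, hb'⟩ :=
    exists_isPositive_coord_eq_cfcₙ φ continuous_negPart negPart_zero negPart_nonneg hy
  simp only [← CFC.posPart_def, ← CFC.negPart_def] at ha' hb'
  refine ⟨a, b, ha, hb, ?_, ?_, ?_⟩ <;> refine ext_coord φ fun α => ?_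
  · rw [map_sub, ha', hb', CFC.posPart_sub_negPart _ (hy.map _)]
  · rw [map_mul, ha', hb', CFC.posPart_mul_negPart, map_zero]
  · rw [map_mul, ha', hb', CFC.negPart_mul_posPart, map_zero]

namespace IsPositivePart

variable {y a a' c : A}

theorem coord_eq (h : IsPositivePart y a) (φ : A ≃⋆ₐ[ℂ] F.limit) (α : Λ) :
    coord φ α a = (coord φ α y)⁺ := by
  obtain ⟨b, ha, hb, rfl, hab, -⟩ := h
  refine (CFC.posPart_negPart_unique (map_sub (coord φ α) a b) ?_ (ha.coord_nonneg φ α)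
    (hb.coord_nonneg φ α)).1.symm
  rw [← map_mul, hab, map_zero]

theorem unique (φ : A ≃⋆ₐ[ℂ] F.limit) (h : IsPositivePart y a) (h' : IsPositivePart y a') :
    a = a' :=
  ext_coord φ fun α => by rw [h.coord_eq, h'.coord_eq]

theorem commute (φ : A ≃⋆ₐ[ℂ] F.limit) (h : IsPositivePart y a) (hc : Commute c y) :
    Commute c a := by
  refine ext_coord φ fun α => ?_
  rw [map_mul, map_mul, h.coord_eq, CFC.posPart_def]
  exact (Commute.cfcₙ_real (hc.map (coord φ α)).symm _).symm

end IsPositivePart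

section Topology

variable [TopologicalSpace A] {φ}

theorem continuous_coord (hφ : IsHomeomorph φ) (α : Λ) : Continuous (coord φ α) :=
  (continuous_apply α).comp (continuous_subtype_val.comp hφ.continuous)

theorem nhds_eq_iInf_comap_coord (hφ : IsHomeomorph φ) (a : A) :
    𝓝 a = ⨅ α, comap (coord φ α) (𝓝 (coord φ α a)) := by
  have hind : IsInducing fun b : A => (φ b : ∀ α, F.obj α) :=
    IsInducing.subtypeVal.comp hφ.isEmbedding.isInducing
  rw [hind.nhds_eq_comap, nhds_pi, Filter.pi, comap_iInf]
  simp only [comap_comap]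
  rfl

theorem exists_preimage_coord_subset [IsDirectedOrder Λ] [Nonempty Λ] (hφ : IsHomeomorph φ)
    {a : A} {U : Set A} (hU : U ∈ 𝓝 a) :
    ∃ α, ∃ V ∈ 𝓝 (coord φ α a), coord φ α ⁻¹' V ⊆ U := by
  have hanti : Antitone fun α => comap (coord φ α) (𝓝 (coord φ α a)) := by
    intro α β h
    have hcomp : (coord φ α : A → F.obj α) = F.map h ∘ coord φ β :=
      funext fun b => (map_coord φ h b).symm
    dsimp only
    rw [hcomp, ← comap_comap]
    exact comap_mono (map_le_iff_le_comap.1 (map_continuous (F.map h)).continuousAt)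
  rw [nhds_eq_iInf_comap_coord hφ, mem_iInf_of_directed hanti.directed_ge] at hU
  exact hU

theorem HasStieltjesIntegral.of_coord [IsDirectedOrder Λ] [Nonempty Λ] (hφ : IsHomeomorph φ)
    {f : ℝ → A} {a b : ℝ} {y : A}
    (h : ∀ α, HasStieltjesIntegral (fun t => coord φ α (f t)) a b (coord φ α y)) :
    HasStieltjesIntegral f a b y := by
  intro U hU
  obtain ⟨α, V, hV, hVU⟩ := exists_preimage_coord_subset hφ hU
  obtain ⟨δ, hδ, hsum⟩ := h α V hV
  refine ⟨δ, hδ, fun n l m hP h0 hn => hVU ?_⟩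
  rw [Set.mem_preimage, map_stieltjesSum]
  exact hsum n l m hP h0 hn

theorem HasStieltjesIntegralLine.of_coord [IsDirectedOrder Λ] [Nonempty Λ]
    (hφ : IsHomeomorph φ) {f : ℝ → A} {y : A}
    (h : ∀ α, HasStieltjesIntegralLine (fun t => coord φ α (f t)) (coord φ α y)) :
    HasStieltjesIntegralLine f y := by
  intro U hU
  obtain ⟨α, V, hV, hVU⟩ := exists_preimage_coord_subset hφ hU
  obtain ⟨δ, hδ, R, hsum⟩ := h α V hV
  refine ⟨δ, hδ, R, fun n l m hP h0 hn => hVU ?_⟩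
  rw [Set.mem_preimage, map_stieltjesSum]
  exact hsum n l m hP h0 hn

/-- The C*-seminorm of `A` given by the norm of the component of index `α`. -/
noncomputable def coordSeminorm (φ : A ≃⋆ₐ[ℂ] F.limit) (α : Λ) : Seminorm ℂ A :=
  (normSeminorm ℂ (F.obj α)).comp (coord φ α : A →ₗ[ℂ] F.obj α)

theorem isContinuousCStarSeminorm_coordSeminorm (hφ : IsHomeomorph φ) (α : Λ) :
    IsContinuousCStarSeminorm (coordSeminorm φ α) where
  mul_le a b := by
    change ‖coord φ α (a * b)‖ ≤ ‖coord φ α a‖ * ‖coord φ α b‖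
    rw [map_mul]
    exact norm_mul_le _ _
  star_mul_self a := by
    change ‖coord φ α (star a * a)‖ = ‖coord φ α a‖ ^ 2
    rw [map_mul, map_star, CStarRing.norm_star_mul_self, sq]
  cont := (continuous_coord hφ α).norm

theorem HasSupNorm.norm_coord_le (hφ : IsHomeomorph φ) {x : A} {M : ℝ} (h : HasSupNorm x M)
    (α : Λ) : ‖coord φ α x‖ ≤ M :=
  h.1 ⟨coordSeminorm φ α, isContinuousCStarSeminorm_coordSeminorm hφ α, rfl⟩

end Topology

end Coordinates

section Rickart

/-- A Rickart *-algebra: the right annihilator of each single element is `gA` for a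
projection `g`. -/
def IsRickartStar (A : Type*) [NonUnitalRing A] [StarRing A] : Prop :=
  ∀ a : A, ∃ g : A, IsStarProjection g ∧ rightAnnihilator {a} = principalRight g

theorem IsBaerStar.isRickartStar {A : Type u} [NonUnitalRing A] [StarRing A]
    (hA : IsBaerStar A) : IsRickartStar A :=
  fun a => hA {a} (Set.singleton_nonempty a)

variable {A : Type*} [NonUnitalRing A] {one a c g p r y : A}

theorem IsUnitElement.commute (h : IsUnitElement one) (c : A) : Commute c one :=
  (h c).2.trans (h c).1.symm

theorem mem_principalRight_iff (hg : IsIdempotentElem g) : y ∈ principalRight g ↔ g * y = y := by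
  refine ⟨?_, fun h => ⟨y, h⟩⟩
  rintro ⟨z, rfl⟩
  exact hg.mul_self_mul z

theorem mul_eq_zero_iff_of_rightAnnihilator_eq (hg : IsIdempotentElem g)
    (h : rightAnnihilator {a} = principalRight g) : a * y = 0 ↔ g * y = y := by
  rw [← mem_principalRight_iff hg, ← h]
  exact ⟨fun hay s hs => hs ▸ hay, fun hy => hy a rfl⟩

variable [StarRing A]

theorem IsRickartStar.exists_isUnitElement (hA : IsRickartStar A) :
    ∃ one : A, IsUnitElement one := by
  obtain ⟨g, hg, hgA⟩ := hA 0
  have hleft : ∀ a, g * a = a := fun a =>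
    (mul_eq_zero_iff_of_rightAnnihilator_eq hg.isIdempotentElem hgA).1 (zero_mul a)
  refine ⟨g, fun a => ⟨hleft a, ?_⟩⟩
  simpa [hg.isSelfAdjoint.star_eq] using congrArg star (hleft (star a))

theorem IsUnitElement.isStarProjection (h : IsUnitElement one) : IsStarProjection one where
  isIdempotentElem := (h one).1
  isSelfAdjoint := by
    have hstar := congrArg star (h (star one)).2
    rwa [star_mul, star_star, (h _).2] at hstar

theorem IsPositive.isSelfAdjoint (ha : IsPositive a) : IsSelfAdjoint a := by
  obtain ⟨b, rfl⟩ := ha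
  exact .star_mul_self b

namespace IsRightSupport

theorem isStarProjection (hone : IsUnitElement one) (hp : IsRightSupport one a p) :
    IsStarProjection p := by
  obtain ⟨g, hg, -, rfl⟩ := hp
  exact hg.sub_of_mul_eq_left hone.isStarProjection (hone g).2

theorem mul_eq_zero_iff (hone : IsUnitElement one) (hp : IsRightSupport one a p) :
    a * r = 0 ↔ p * r = 0 := by
  obtain ⟨g, hg, hgA, rfl⟩ := hp
  rw [mul_eq_zero_iff_of_rightAnnihilator_eq hg.isIdempotentElem hgA, sub_mul, (hone r).1,
    sub_eq_zero, eq_comm]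

theorem mul_eq (hone : IsUnitElement one) (hp : IsRightSupport one a p) : a * p = a := by
  have h : a * (one - p) = 0 := by
    rw [hp.mul_eq_zero_iff hone, mul_sub, (hone p).2,
      (hp.isStarProjection hone).isIdempotentElem.eq, sub_self]
  rw [mul_sub, (hone a).2, sub_eq_zero] at h
  exact h.symm

theorem mul_mul_eq_of_commute (hone : IsUnitElement one) (hp : IsRightSupport one a p)
    (hc : Commute c a) : p * c * p = p * c := by
  have h : a * (c * (one - p)) = 0 := by
    rw [← mul_assoc, ← hc.eq, mul_assoc, mul_sub, (hone a).2, hp.mul_eq hone, sub_self, mul_zero]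
  rw [hp.mul_eq_zero_iff hone, ← mul_assoc, mul_sub, (hone _).2, sub_eq_zero] at h
  exact h.symm

theorem commute (hone : IsUnitElement one) (hp : IsRightSupport one a p) (hc : Commute c a)
    (hc' : Commute (star c) a) : Commute c p := by
  have hstar : p * c * p = c * p := by
    simpa [(hp.isStarProjection hone).isSelfAdjoint.star_eq, mul_assoc] using
      congrArg star (hp.mul_mul_eq_of_commute hone hc')
  exact hstar.symm.trans (hp.mul_mul_eq_of_commute hone hc)

end IsRightSupport

namespace IsPositivePart

theorem isPositive (h : IsPositivePart y a) : IsPositive a :=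
  let ⟨_, ha, _⟩ := h
  ha

theorem isPositive_sub (h : IsPositivePart y a) : IsPositive (a - y) := by
  obtain ⟨b, -, hb, rfl, -⟩ := h
  rwa [sub_sub_cancel]

theorem mul_rightSupport (h : IsPositivePart y a) (hone : IsUnitElement one)
    (hp : IsRightSupport one a p) : y * p = a := by
  obtain ⟨b, -, hb, rfl, hab, -⟩ := h
  have hpb : p * b = 0 := (hp.mul_eq_zero_iff hone).1 hab
  have hbp : b * p = 0 := by
    simpa [hb.isSelfAdjoint.star_eq, (hp.isStarProjection hone).isSelfAdjoint.star_eq] using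
      congrArg star hpb
  rw [sub_mul, hbp, sub_zero, hp.mul_eq hone]

end IsPositivePart

end Rickart

section MaximalCommutative

variable {A : Type u} [NonUnitalRing A] [StarRing A] [Module ℂ A] [IsScalarTower ℂ A A]
  [SMulCommClass ℂ A A] [StarModule ℂ A]

theorem IsMaximalCommutative.mem_of_commute {B : NonUnitalStarSubalgebra ℂ A}
    (hB : IsMaximalCommutative B) {p : A} (hp : IsSelfAdjoint p) (hpB : ∀ b ∈ B, Commute b p) :
    p ∈ B := by
  set S : Set A := insert p B
  have hcomm : ∀ a ∈ S, ∀ b ∈ S, a * b = b * a := by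
    rintro a (rfl | ha) b (rfl | hb)
    · rfl
    · exact (hpB b hb).symm
    · exact hpB a ha
    · exact hB.prop a ha b hb
  have hstar : ∀ b ∈ S, star b ∈ S := by
    rintro b (rfl | hb)
    · exact .inl hp
    · exact .inr (star_mem hb)
  have hadjoin := NonUnitalStarAlgebra.isMulCommutative_adjoin ℂ hcomm
    fun a ha b hb => hcomm a ha _ (hstar b hb)
  have hle : NonUnitalStarAlgebra.adjoin ℂ S ≤ B :=
    hB.le_of_ge
      (fun a ha b hb => congrArg Subtype.val (hadjoin.is_comm.comm ⟨a, ha⟩ ⟨b, hb⟩))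
      (fun b hb => NonUnitalStarAlgebra.subset_adjoin ℂ S (.inr hb))
  exact hle (NonUnitalStarAlgebra.subset_adjoin ℂ S (.inl rfl))

end MaximalCommutative

section CutFamily

variable {A : Type u} [NonUnitalRing A] [StarRing A] [Module ℂ A]
  {Λ : Type u} [PartialOrder Λ] {F : ProjectiveFamily Λ} {φ : A ≃⋆ₐ[ℂ] F.limit}
  {one x p : A} {e f : ℝ → A} {s t : ℝ}

/-- The projections `e t` cut `x` at the level `t` in every component of the projective limit. -/
def IsCutFamily (φ : A ≃⋆ₐ[ℂ] F.limit) (one x : A) (e : ℝ → A) : Prop :=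
  ∀ α t, IsCut (coord φ α one) (coord φ α x) t (coord φ α (e t))

namespace IsCutFamily

theorem isStarProjection (he : IsCutFamily φ one x e) (t : ℝ) : IsStarProjection (e t) :=
  isStarProjection_of_coord φ fun α => (he α t).isProj

theorem projLE_of_lt (hone : IsUnitElement one) (he : IsCutFamily φ one x e)
    (hf : IsCutFamily φ one x f) (hst : s < t) : ProjLE (e s) (f t) :=
  projLE_of_coord φ fun α => (he α s).projLE_of_lt (hone.isStarProjection.map (coord φ α))
    ((hone.commute x).map (coord φ α)) (hf α t) hst

theorem isProjectionChain (hone : IsUnitElement one) (he : IsCutFamily φ one x e) :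
    IsProjectionChain e where
  isProj := he.isStarProjection
  mono s t hst := by
    rcases hst.eq_or_lt with rfl | hlt
    · exact (he.isStarProjection s).isIdempotentElem.eq.symm
    · exact he.projLE_of_lt hone he hlt

theorem isSpectralResolution (hone : IsUnitElement one) (he : IsCutFamily φ one x e) (α : Λ) :
    IsSpectralResolution (coord φ α x) fun t => coord φ α (e t) :=
  .of_isCut ((he.isProjectionChain hone).map (coord φ α)).mono (he α)

theorem coord_eq_one (hone : IsUnitElement one) (he : IsCutFamily φ one x e) {α : Λ}
    (ht : ‖coord φ α x‖ < t) : coord φ α (e t) = coord φ α one :=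
  (he α t).eq_unit_of_norm_lt (hone.isStarProjection.map (coord φ α)) ht

theorem coord_eq_zero (he : IsCutFamily φ one x e) {α : Λ} (ht : t < -‖coord φ α x‖) :
    coord φ α (e t) = 0 :=
  (he α t).eq_zero_of_lt_neg_norm ht

theorem isProjSup_range (hone : IsUnitElement one) (he : IsCutFamily φ one x e) :
    IsProjSup (Set.range e) one := by
  refine ⟨hone.isStarProjection, fun p _ => (hone p).2.symm, fun q _ hq => ?_⟩
  refine projLE_of_coord φ fun α => ?_
  rw [← he.coord_eq_one hone (lt_add_one ‖coord φ α x‖)]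
  exact (hq _ ⟨_, rfl⟩).map (coord φ α)

theorem isProjInf_range (he : IsCutFamily φ one x e) : IsProjInf (Set.range e) 0 := by
  refine ⟨.zero _, fun p _ => (zero_mul p).symm, fun q _ hq => ?_⟩
  refine projLE_of_coord φ fun α => ?_
  rw [map_zero, ← he.coord_eq_zero (sub_one_lt (-‖coord φ α x‖))]
  exact (hq _ ⟨_, rfl⟩).map (coord φ α)

theorem isSpectralFamily (hone : IsUnitElement one) (he : IsCutFamily φ one x e)
    (hleft : ∀ t, IsProjSup (e '' Set.Iio t) (e t)) : IsSpectralFamily one e where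
  isProj := he.isStarProjection
  mono := (he.isProjectionChain hone).mono
  sup_eq_one := he.isProjSup_range hone
  inf_eq_zero := he.isProjInf_range
  left_cont := hleft

theorem eq_of_isSpectralFamily (hone : IsUnitElement one) (he : IsCutFamily φ one x e)
    (hf : IsCutFamily φ one x f) (he' : IsSpectralFamily one e) (hf' : IsSpectralFamily one f) :
    e = f :=
  funext fun t => ProjLE.antisymm
    (he'.projLE_of_forall_lt hf' (fun _ _ hst => he.projLE_of_lt hone hf hst) t)
    (hf'.projLE_of_forall_lt he' (fun _ _ hst => hf.projLE_of_lt hone he hst) t)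
    (he'.isProj t) (hf'.isProj t)

theorem eq_zero_of_forall_norm_coord_le (he : IsCutFamily φ one x e)
    (hleft : IsProjSup (e '' Set.Iio t) (e t)) (hx : ∀ α, ‖coord φ α x‖ ≤ -t) : e t = 0 := by
  have hzero : ∀ s < t, e s = 0 := fun s hs => ext_coord φ fun α => by
    rw [he.coord_eq_zero (by linarith [hx α]), map_zero]
  have hle : ProjLE (e t) 0 := by
    refine hleft.2.2 0 (.zero _) ?_
    rintro _ ⟨s, hs, rfl⟩
    rw [hzero s hs, ProjLE, mul_zero]
  exact hle.trans (mul_zero _)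

variable [TopologicalSpace A] [IsDirectedOrder Λ] [Nonempty Λ]

theorem hasStieltjesIntegralLine (hφ : IsHomeomorph φ) (hone : IsUnitElement one)
    (he : IsCutFamily φ one x e) : HasStieltjesIntegralLine e x := by
  refine .of_coord hφ fun α => (he.isSpectralResolution hone α).hasStieltjesIntegralLine ?_ ?_
  · filter_upwards [eventually_lt_atBot (-‖coord φ α x‖)] with t ht
    exact he.coord_eq_zero ht
  · filter_upwards [eventually_gt_atTop ‖coord φ α x‖] with t ht
    rw [he.coord_eq_one hone ht, ← map_mul, (hone x).2]

theorem hasStieltjesIntegral (hφ : IsHomeomorph φ) (hone : IsUnitElement one)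
    (he : IsCutFamily φ one x e) {M ε : ℝ} (hleft : IsProjSup (e '' Set.Iio (-M)) (e (-M)))
    (hM : HasSupNorm x M) (hε : 0 < ε) : HasStieltjesIntegral e (-M) (M + ε) x := by
  have hnorm : ∀ α, ‖coord φ α x‖ ≤ M := hM.norm_coord_le hφ
  refine .of_coord hφ fun α => (he.isSpectralResolution hone α).hasStieltjesIntegral ?_
  rw [he.eq_zero_of_forall_norm_coord_le hleft (by simpa only [neg_neg] using hnorm),
    he.coord_eq_one hone ((hnorm α).trans_lt (lt_add_of_pos_right M hε)), map_zero, sub_zero,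
    ← map_mul, (hone x).2]

end IsCutFamily

theorem IsProjSup.eventually_coord_eq (hf : IsProjectionChain f)
    (hconst : ∀ α, EventuallyConst (fun t => coord φ α (f t)) atTop)
    (hp : IsProjSup (Set.range f) p) (α : Λ) :
    ∀ᶠ t in atTop, coord φ α (f t) = coord φ α p := by
  obtain ⟨q, hq_proj, hq⟩ := exists_isStarProjection_eventually_coord_eq φ hf.isProj hconst
  have hqp : ProjLE q p := projLE_of_coord φ fun β => by
    obtain ⟨t, ht⟩ := (hq β).exists
    exact ht ▸ (hp.2.1 _ ⟨t, rfl⟩).map (coord φ β)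
  have hpq : ProjLE p q := by
    refine hp.2.2 q hq_proj ?_
    rintro _ ⟨s, rfl⟩
    refine projLE_of_coord φ fun β => ?_
    obtain ⟨t, ht, hst⟩ := ((hq β).and (eventually_ge_atTop s)).exists
    exact ht ▸ (hf.mono s t hst).map (coord φ β)
  exact hpq.antisymm hqp hp.1 hq_proj ▸ hq α

theorem IsProjInf.eventually_coord_eq (hf : IsProjectionChain f)
    (hconst : ∀ α, EventuallyConst (fun t => coord φ α (f t)) atBot)
    (hp : IsProjInf (Set.range f) p) (α : Λ) :
    ∀ᶠ t in atBot, coord φ α (f t) = coord φ α p := by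
  obtain ⟨q, hq_proj, hq⟩ := exists_isStarProjection_eventually_coord_eq φ hf.isProj hconst
  have hpq : ProjLE p q := projLE_of_coord φ fun β => by
    obtain ⟨t, ht⟩ := (hq β).exists
    exact ht ▸ (hp.2.1 _ ⟨t, rfl⟩).map (coord φ β)
  have hqp : ProjLE q p := by
    refine hp.2.2 q hq_proj ?_
    rintro _ ⟨s, rfl⟩
    refine projLE_of_coord φ fun β => ?_
    obtain ⟨t, ht, hts⟩ := ((hq β).and (eventually_le_atBot s)).exists
    exact ht ▸ (hf.mono t s hts).map (coord φ β)
  exact hpq.antisymm hqp hp.1 hq_proj ▸ hq α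

theorem IsSpectralFamily.isCutFamily [TopologicalSpace A] (hφ : IsHomeomorph φ)
    (hf : IsSpectralFamily one f) (hx : HasStieltjesIntegralLine f x) :
    IsCutFamily φ one x f := by
  have hres : ∀ α, IsSpectralResolution (coord φ α x) fun t => coord φ α (f t) := fun α =>
    (hf.isProjectionChain.map (coord φ α)).isSpectralResolution
      (hx.map (coord φ α) (continuous_coord hφ α))
  have hbot := hf.inf_eq_zero.eventually_coord_eq hf.isProjectionChain
    fun α => (hres α).eventuallyConst_atBot
  have htop := hf.sup_eq_one.eventually_coord_eq hf.isProjectionChain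
    fun α => (hres α).eventuallyConst_atTop
  intro α t
  obtain ⟨s, hs, hst⟩ := ((hbot α).and (eventually_le_atBot t)).exists
  obtain ⟨r, hr, htr⟩ := ((htop α).and (eventually_ge_atTop t)).exists
  exact (hres α).isCut hst htr (hs.trans (map_zero _)) hr

end CutFamily

section SpectralProjection

variable {A : Type u} [NonUnitalRing A] [StarRing A] [Module ℂ A]
  {Λ : Type u} [PartialOrder Λ] {F : ProjectiveFamily Λ}
  {one x a c p : A} {e : ℝ → A} {t : ℝ}

/-- `p` is the right support of the positive part of `t 1 - x`. -/
def IsSpectralProjection (one x : A) (t : ℝ) (p : A) : Prop :=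
  ∃ a, IsPositivePart ((t : ℂ) • one - x) a ∧ IsRightSupport one a p

theorem IsRickartStar.exists_isSpectralProjection [StarModule ℂ A] (φ : A ≃⋆ₐ[ℂ] F.limit)
    (hA : IsRickartStar A) (hone : IsUnitElement one) (hx : IsSelfAdjoint x) (t : ℝ) :
    ∃ p, IsSpectralProjection one x t p := by
  have hself : IsSelfAdjoint ((t : ℂ) • one - x) :=
    (IsSelfAdjoint.smul (Complex.conj_ofReal t) hone.isStarProjection.isSelfAdjoint).sub hx
  obtain ⟨a, ha⟩ := exists_isPositivePart φ hself
  obtain ⟨g, hg, hgA⟩ := hA a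
  exact ⟨one - g, a, ha, g, hg, hgA, rfl⟩

namespace IsSpectralProjection

theorem existsUnique_isPositivePart (φ : A ≃⋆ₐ[ℂ] F.limit)
    (hp : IsSpectralProjection one x t p) : ∃! a, IsPositivePart ((t : ℂ) • one - x) a :=
  let ⟨a, ha, _⟩ := hp
  ⟨a, ha, fun _ hb => hb.unique φ ha⟩

theorem isRightSupport (φ : A ≃⋆ₐ[ℂ] F.limit) (hp : IsSpectralProjection one x t p)
    (ha : IsPositivePart ((t : ℂ) • one - x) a) : IsRightSupport one a p := by
  obtain ⟨b, hb, hbp⟩ := hp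
  rwa [ha.unique φ hb]

theorem isStarProjection (hone : IsUnitElement one) (hp : IsSpectralProjection one x t p) :
    IsStarProjection p :=
  let ⟨_, _, hap⟩ := hp
  hap.isStarProjection hone

theorem commute [IsScalarTower ℂ A A] [SMulCommClass ℂ A A] (φ : A ≃⋆ₐ[ℂ] F.limit)
    (hone : IsUnitElement one) (hx : IsSelfAdjoint x) (hp : IsSpectralProjection one x t p)
    (hc : Commute c x) : Commute c p := by
  obtain ⟨a, ha, hap⟩ := hp
  have hca : ∀ {d : A}, Commute d x → Commute d a := fun hd =>
    ha.commute φ (((hone.commute _).smul_right _).sub_right hd)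
  have hc' : Commute (star c) x := by
    simpa only [hx.star_eq] using hc.star_star
  exact hap.commute hone (hca hc) (hca hc')

theorem mem_of_isMaximalCommutative [IsScalarTower ℂ A A] [SMulCommClass ℂ A A]
    [StarModule ℂ A] (φ : A ≃⋆ₐ[ℂ] F.limit) (hone : IsUnitElement one) (hx : IsSelfAdjoint x)
    (hp : IsSpectralProjection one x t p) {B : NonUnitalStarSubalgebra ℂ A}
    (hB : IsMaximalCommutative B) (hxB : x ∈ B) : p ∈ B :=
  hB.mem_of_commute (hp.isStarProjection hone).isSelfAdjoint fun b hb =>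
    hp.commute φ hone hx (hB.prop b hb x hxB)

theorem isCut [IsScalarTower ℂ A A] [SMulCommClass ℂ A A] (φ : A ≃⋆ₐ[ℂ] F.limit)
    (hone : IsUnitElement one) (hx : IsSelfAdjoint x) (hp : IsSpectralProjection one x t p)
    (α : Λ) : IsCut (coord φ α one) (coord φ α x) t (coord φ α p) where
  isProj := (hp.isStarProjection hone).map (coord φ α)
  projLE_unit := ProjLE.map (coord φ α) (hone p).2.symm
  commute := (hp.commute φ hone hx (Commute.refl x)).map (coord φ α)
  mul_le := by
    obtain ⟨a, ha, hap⟩ := hp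
    have hbelow : t • coord φ α p - coord φ α x * coord φ α p = coord φ α a := by
      rw [← ha.mul_rightSupport hone hap, sub_mul, smul_mul_assoc, (hone p).1, map_sub,
        coord_ofReal_smul, map_mul]
    exact sub_nonneg.1 (hbelow ▸ ha.isPositive.coord_nonneg φ α)
  le_mul := by
    obtain ⟨a, ha, hap⟩ := hp
    have habove : x * (one - p) - (t : ℂ) • (one - p) = a - ((t : ℂ) • one - x) := by
      rw [← ha.mul_rightSupport hone hap, sub_mul, smul_mul_assoc, (hone p).1, mul_sub,
        (hone x).2, smul_sub]
      abel
    have hnonneg := ha.isPositive_sub.coord_nonneg φ α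
    rw [← habove, map_sub, map_mul, coord_ofReal_smul, map_sub] at hnonneg
    exact sub_nonneg.1 hnonneg

theorem smul_sub_mul_mul_eq_zero_iff [IsScalarTower ℂ A A] (hone : IsUnitElement one)
    (hp : IsSpectralProjection one x t p) {r : A} :
    ((t : ℂ) • p - x * p) * r = 0 ↔ p * r = 0 := by
  obtain ⟨a, ha, hap⟩ := hp
  rw [← hap.mul_eq_zero_iff hone, ← ha.mul_rightSupport hone hap, sub_mul _ x p,
    smul_mul_assoc, (hone p).1]

variable [IsScalarTower ℂ A A] [SMulCommClass ℂ A A]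

theorem isProjSup_image_Iio (φ : A ≃⋆ₐ[ℂ] F.limit) (hone : IsUnitElement one)
    (hx : IsSelfAdjoint x) (he : ∀ t, IsSpectralProjection one x t (e t)) (t : ℝ) :
    IsProjSup (e '' Set.Iio t) (e t) := by
  have hcut : IsCutFamily φ one x e := fun α t => (he t).isCut φ hone hx α
  refine ⟨hcut.isStarProjection t, ?_, fun q _ hq => ?_⟩
  · rintro _ ⟨s, hs, rfl⟩
    exact hcut.projLE_of_lt hone hcut hs
  have hq_below : ∀ s < t, e s * (one - q) = 0 := fun s hs => by
    rw [mul_sub, (hone _).2, ← hq _ ⟨s, hs, rfl⟩, sub_self]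
  have hq_zero : ((t : ℂ) • e t - x * e t) * (one - q) = 0 := ext_coord φ fun α => by
    rw [map_zero, map_mul, map_sub, coord_ofReal_smul, map_mul]
    refine (hcut.isSpectralResolution hone α).smul_sub_mul_mul_eq_zero fun s hs => ?_
    rw [← map_mul, hq_below s hs, map_zero]
  rw [(he t).smul_sub_mul_mul_eq_zero_iff hone, mul_sub, (hone _).2] at hq_zero
  exact sub_eq_zero.1 hq_zero

end IsSpectralProjection

end SpectralProjection

end LocallyAW

open LocallyAW in
theorem theorem4_general {A : Type u} [NonUnitalRing A] [StarRing A] [Module ℂ A]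
    [IsScalarTower ℂ A A] [SMulCommClass ℂ A A] [StarModule ℂ A] [TopologicalSpace A]
    (hA : IsLocallyCStarAlgebra A) (hA' : IsRickartStar A) :
    ∃ one : A, IsUnitElement one ∧
      ∀ x : A, IsSelfAdjoint x →
        ∃ e : ℝ → A,
          IsSpectralFamily one e ∧
          (∀ t : ℝ, (∃! a, IsPositivePart ((t : ℂ) • one - x) a) ∧
            ∀ a, IsPositivePart ((t : ℂ) • one - x) a → IsRightSupport one a (e t)) ∧
          (∀ B : NonUnitalStarSubalgebra ℂ A, IsMaximalCommutative B → x ∈ B → ∀ t, e t ∈ B) ∧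
          HasStieltjesIntegralLine e x ∧
          (∀ M : ℝ, HasSupNorm x M → ∀ ε > 0, HasStieltjesIntegral e (-M) (M + ε) x) ∧
          ∀ f : ℝ → A, IsSpectralFamily one f → HasStieltjesIntegralLine f x → f = e := by
  obtain ⟨Λ, _, _, _, F, φ, hφ⟩ := hA
  obtain ⟨one, hone⟩ := hA'.exists_isUnitElement
  refine ⟨one, hone, fun x hx => ?_⟩
  choose e he using hA'.exists_isSpectralProjection φ hone hx
  have hcut : IsCutFamily φ one x e := fun α t => (he t).isCut φ hone hx α
  have hleft := IsSpectralProjection.isProjSup_image_Iio φ hone hx he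
  have hfamily : IsSpectralFamily one e := hcut.isSpectralFamily hone hleft
  exact ⟨e, hfamily,
    fun t => ⟨(he t).existsUnique_isPositivePart φ, fun _ ha => (he t).isRightSupport φ ha⟩,
    fun _ hB hxB t => (he t).mem_of_isMaximalCommutative φ hone hx hB hxB,
    hcut.hasStieltjesIntegralLine hφ hone,
    fun M hM _ hε => hcut.hasStieltjesIntegral hφ hone (hleft (-M)) hM hε,
    fun _ hf hfx => (hf.isCutFamily hφ hfx).eq_of_isSpectralFamily hone hcut hf hfamily⟩

theorem theorem4 {A : Type u} [NonUnitalRing A] [StarRing A] [Module ℂ A]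
    [IsScalarTower ℂ A A] [SMulCommClass ℂ A A] [StarModule ℂ A] [TopologicalSpace A]
    (hA : LocallyAW.IsLocallyAWStarAlgebra A) :
    ∃ one : A, LocallyAW.IsUnitElement one ∧
      ∀ x : A, IsSelfAdjoint x →
        ∃ e : ℝ → A,
          LocallyAW.IsSpectralFamily one e ∧
          -- `e t` is the right support of the positive part of `t 1 - x`
          (∀ t : ℝ, (∃! a, LocallyAW.IsPositivePart ((t : ℂ) • one - x) a) ∧
            ∀ a, LocallyAW.IsPositivePart ((t : ℂ) • one - x) a →
              LocallyAW.IsRightSupport one a (e t)) ∧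
          (∀ B : NonUnitalStarSubalgebra ℂ A, LocallyAW.IsMaximalCommutative B → x ∈ B →
            ∀ t, e t ∈ B) ∧
          LocallyAW.HasStieltjesIntegralLine e x ∧
          (∀ M : ℝ, LocallyAW.HasSupNorm x M →
            ∀ ε > 0, LocallyAW.HasStieltjesIntegral e (-M) (M + ε) x) ∧
          ∀ f : ℝ → A, LocallyAW.IsSpectralFamily one f →
            LocallyAW.HasStieltjesIntegralLine f x → f = e :=
  theorem4_general hA.locallyCStar hA.baer.isRickartStar
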